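/- An oriented graph is a finite graph with directed edges, without loops, multiple arcs or digons. A substructure $G'(V',E')$ of an oriented graph $G(V,E)$ consists of subsets $V'\subseteq V$ and $E'\subseteq E$; edges in $E'$ may have endpoints outside $V'$. For $|\omega|=1$ its Hermitian Laplacian matrix $L_\omega=(l_{uv})_{u,v\in V'}$ has $l_{uu}=\#\{e\in E': u \text{ is an endpoint of } e\}$ and, for $u\neq v$, $l_{uv}=-\omega$ if $u\to v$ is in $E'$, $l_{uv}=-\overline{\omega}$ if $v\to u$ is in $E'$, and $l_{uv}=0$ otherwise. Two vertices of $V'$ are connected if they are joined by a path (ignoring directions) with all vertices in $V'$ and all edges in $E'$; the connected components of $G'$ are the substructures $(V'_i,E'_i)$ in which $V'_i$ is a class of mutually connected vertices and $E'_i$ is the set of edges in $E'$ with at least one endpoint in $V'_i$. $G'$ is all-regular if $|V'_i|=|E'_i|$ for every connected component. A unicyclic graph is a connected substructure all of whose edges have both endpoints in its vertex set and which contains exactly one cycle; let $k$ be the length of this cycle and $g$ the number of its negative edges, i.e. the edges directed against the more frequent of the two directions around the cycle, so $0\le g\le\lfloor k/2\rfloor$. It is called alpha if $k-2g\equiv 2,3\pmod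 5$, beta if $k-2g\equiv 1,4\pmod 5$, and vanishing if $5\mid k-2g$. Theorem. Let $\omega_5=e^{2\pi i/5}$, $\omega_5^2=e^{4\pi i/5}$ and $\phi=(1+\sqrt5)/2$. Let $G'(V',E')$ be an all-regular substructure of an oriented graph such that exactly $n_\alpha$ of its connected components are alpha unicyclic graphs, exactly $n_\beta$ are beta unicyclic graphs, and none is a vanishing unicyclic graph. Then $\det L_{\omega_5}$ and $\det L_{\omega_5^2}$ of $G'$ are positive real numbers, and $$n_\alpha+n_\beta=\log_5\bigl[(\det L_{\omega_5})(\det L_{\omega_5^2})\bigr],\qquad n_\alpha-n_\beta=\log_{\phi^2}\left(\frac{\det L_{\omega_5}}{\det L_{\omega_5^2}}\right).$$ -/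

import Mathlib

/-- A graph with directed edges, without multiple arcs, digons or loops
(`asymm` with `u = v` excludes loops). `Adj u v` means `u → v`. -/
structure OrientedGraph (V : Type*) extends Digraph V where
  asymm : ∀ u v, Adj u v → ¬ Adj v u

namespace OrientedGraph

variable {V : Type*} [DecidableEq V] {G : OrientedGraph V}

/-- A substructure `(V', E')`: a set of vertices and a set of edges of `G`. Edges in `E'` may have
endpoints outside `V'`. The edge `u → v` is the pair `(u, v)`. -/
structure Substructure (G : OrientedGraph V) where
  verts : Finset V
  edges : Finset (V × V)
  adj_of_mem_edges : ∀ e ∈ edges, G.Adj e.1 e.2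

namespace Substructure

/-- The degree of `u` in the substructure: the number of edges of `E'` that start or end at `u`,
whether or not the other endpoint lies in `V'`. -/
def degree (H : G.Substructure) (u : V) : ℕ :=
  (H.edges.filter fun e => e.1 = u ∨ e.2 = u).card

/-- The Hermitian Laplacian matrix of a substructure with parameter `ω`, indexed by `V'`. -/
noncomputable def laplacian (H : G.Substructure) (ω : ℂ) : Matrix H.verts H.verts ℂ :=
  Matrix.of fun u v =>
    if u = v then (H.degree u : ℂ)
    else if ((u : V), (v : V)) ∈ H.edges then -ω
    else if ((v : V), (u : V)) ∈ H.edges then -(starRingEnd ℂ) ω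
    else 0

/-- The undirected graph on `V'` in which two vertices are adjacent if an edge of `E'` joins them.
Its reachability relation is connectedness of vertices in the substructure. -/
def graph (H : G.Substructure) : SimpleGraph H.verts where
  Adj u v := ((u : V), (v : V)) ∈ H.edges ∨ ((v : V), (u : V)) ∈ H.edges
  symm := ⟨fun _ _ h => h.symm⟩
  loopless := ⟨fun u h => by
    have h' : G.Adj u u := by
      rcases h with h | h <;> exact H.adj_of_mem_edges _ h
    exact G.asymm _ _ h' h'⟩

/-- A vertex of `V` lies in the part `c` of `V'`. -/
def InComponent (H : G.Substructure) (c : H.graph.ConnectedComponent) (v : V) : Prop :=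
  ∃ h : v ∈ H.verts, H.graph.connectedComponentMk ⟨v, h⟩ = c

open Classical in
/-- The connected component with vertex set `c`, as a substructure: its edges are the edges of `E'`
with at least one endpoint in `c`. -/
noncomputable def component (H : G.Substructure) (c : H.graph.ConnectedComponent) :
    G.Substructure where
  verts := H.verts.filter fun v => H.InComponent c v
  edges := H.edges.filter fun e => H.InComponent c e.1 ∨ H.InComponent c e.2
  adj_of_mem_edges e he := H.adj_of_mem_edges e (Finset.mem_filter.1 he).1

/-- A substructure with as many vertices as edges. -/
def IsRegular (H : G.Substructure) : Prop :=
  H.verts.card = H.edges.card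

/-- Every connected component is regular. -/
def IsAllRegular (H : G.Substructure) : Prop :=
  ∀ c : H.graph.ConnectedComponent, (H.component c).IsRegular

/-- The number of steps of a walk that follow the direction of the edge. -/
def forwardCount (H : G.Substructure) {u v : H.verts} (w : H.graph.Walk u v) : ℕ :=
  w.darts.countP fun d => ((d.fst : V), (d.snd : V)) ∈ H.edges

/-- The number of steps of a walk that go against the direction of the edge. -/
def backwardCount (H : G.Substructure) {u v : H.verts} (w : H.graph.Walk u v) : ℕ :=
  w.darts.countP fun d => ((d.snd : V), (d.fst : V)) ∈ H.edges

/-- The number of negative edges of a cycle, where the positive direction of the cycle is the one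
that occurs more often. -/
def negativeCount (H : G.Substructure) {u v : H.verts} (w : H.graph.Walk u v) : ℕ :=
  min (H.forwardCount w) (H.backwardCount w)

/-- The substructure is a unicyclic graph whose cycle has `k` edges, `g` of which are negative:
it is a graph (its edges have both endpoints in its vertex set), it is connected, and it contains
exactly one cycle (a cycle being identified with its set of edges). -/
def IsUnicyclic (H : G.Substructure) (k g : ℕ) : Prop :=
  (∀ e ∈ H.edges, e.1 ∈ H.verts ∧ e.2 ∈ H.verts) ∧
  H.graph.Connected ∧
  ∃ (u : H.verts) (w : H.graph.Walk u u),
    w.IsCycle ∧ w.length = k ∧ H.negativeCount w = g ∧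
    ∀ (u' : H.verts) (w' : H.graph.Walk u' u'), w'.IsCycle → ∀ e, e ∈ w'.edges ↔ e ∈ w.edges

/-- Unicyclic graph with `k - 2g ≡ 2, 3 (mod 5)`. -/
def IsAlpha (H : G.Substructure) : Prop :=
  ∃ k g : ℕ, H.IsUnicyclic k g ∧
    ((k : ℤ) - 2 * g ≡ 2 [ZMOD 5] ∨ (k : ℤ) - 2 * g ≡ 3 [ZMOD 5])

/-- Unicyclic graph with `k - 2g ≡ 1, 4 (mod 5)`. -/
def IsBeta (H : G.Substructure) : Prop :=
  ∃ k g : ℕ, H.IsUnicyclic k g ∧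
    ((k : ℤ) - 2 * g ≡ 1 [ZMOD 5] ∨ (k : ℤ) - 2 * g ≡ 4 [ZMOD 5])

/-- Unicyclic graph with `5 ∣ k - 2g`. -/
def IsVanishing (H : G.Substructure) : Prop :=
  ∃ k g : ℕ, H.IsUnicyclic k g ∧ (5 : ℤ) ∣ (k : ℤ) - 2 * g

/-- The number of connected components that are alpha unicyclic graphs. -/
noncomputable def numAlpha (H : G.Substructure) : ℕ :=
  Set.ncard {c : H.graph.ConnectedComponent | (H.component c).IsAlpha}

/-- The number of connected components that are beta unicyclic graphs. -/
noncomputable def numBeta (H : G.Substructure) : ℕ :=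
  Set.ncard {c : H.graph.ConnectedComponent | (H.component c).IsBeta}

/-- The number of connected components that are vanishing unicyclic graphs. -/
noncomputable def numVanishing (H : G.Substructure) : ℕ :=
  Set.ncard {c : H.graph.ConnectedComponent | (H.component c).IsVanishing}

end Substructure

end OrientedGraph

/-- `ω₅ = exp(2πi/5)`. -/
noncomputable def omegaFive : ℂ := Complex.exp (2 * Real.pi * Complex.I / 5)

/-!
The Laplacian matrix of a substructure is `M * Mᴴ`, where the incidence matrix `M` has one column
`e_u - ω̄ e_v` for each edge `u → v`, a basis vector outside the substructure counting as zero. The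
Laplacian is block diagonal along the connected components, and for a regular component `M` is
square, so that the determinant of the block is `|det M| ^ 2`.

Let `e₀` be an edge of a connected regular component whose removal leaves the vertices connected,
and let `D v` be the determinant of `M` with the column of `e₀` replaced by the basis vector `e_v`.
Replacing that column by the column of another edge `u → v` gives zero, hence `D u = ω̄ D v`. Thus
all `D v` have the same norm, and this norm is one (`norm_cofactor`): scaling row `v` by `D v`, and
the columns accordingly, replaces `ω` by `1`, and over any commutative ring (in particular over
`ℤ`) the determinant is a unit, because connectedness lets the columns span all basis vectors
(`isUnit_cofactor`).

Expanding `det M` along the column of `e₀` leaves two cases. If some edge is half-open, the rest is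
a tree and this edge is taken as `e₀`: the determinant of the block is `1` (`det_laplacian_eq_one`).
Otherwise there is exactly one cycle (`exists_isUnicyclic`), and `e₀` is taken on it. Following `D`
around the cycle shows that the determinant of the block is `|1 - ω ^ (k - 2g)| ^ 2`
(`IsUnicyclic.det_laplacian`). At `ω₅` this is `√5 φ` for alpha graphs and `√5 / φ` for beta graphs,
and at `ω₅²` the two values are exchanged. The product of the two values is `5`, and their quotient
is `φ ^ 2` or its inverse.
-/

namespace OrientedGraph.Substructure


variable {V : Type*} {G : OrientedGraph V}

/-! ### Incidence matrix -/

lemma ne_of_mem_edges (H : G.Substructure) {e : V × V} (he : e ∈ H.edges) : e.1 ≠ e.2 := by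
  intro h
  have h1 := H.adj_of_mem_edges e he
  rw [h] at h1
  exact G.asymm _ _ h1 h1

lemma swap_notMem_edges (H : G.Substructure) {u v : V} (he : (u, v) ∈ H.edges) :
    (v, u) ∉ H.edges := fun h =>
  G.asymm _ _ (H.adj_of_mem_edges _ he) (H.adj_of_mem_edges _ h)

variable [DecidableEq V]

/-- The incidence matrix of a substructure with parameter `c`: the column of an edge `u → v` has
entry `1` at `u` and `-c` at `v`. A row is present only for the vertices of the substructure, so
the column of an edge with an endpoint outside has a single nonzero entry. -/
def incidence {R : Type*} [CommRing R] (H : G.Substructure) (c : R) : Matrix H.verts H.edges R :=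
  Matrix.of fun v e => (if e.1.1 = v then 1 else 0) - (if e.1.2 = v then c else 0)

/-- The substructure without the edge `e`. -/
def erase (H : G.Substructure) (e : V × V) : G.Substructure where
  verts := H.verts
  edges := H.edges.erase e
  adj_of_mem_edges e' he := H.adj_of_mem_edges e' (Finset.mem_of_mem_erase he)

lemma laplacian_eq_incidence_mul_conjTranspose (H : G.Substructure) {ω : ℂ} (hω : ‖ω‖ = 1) :
    H.laplacian ω =
      H.incidence (starRingEnd ℂ ω) * (H.incidence (starRingEnd ℂ ω)).conjTranspose := by
  have hn : starRingEnd ℂ ω * ω = 1 := by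
    rw [← Complex.normSq_eq_conj_mul_self, Complex.normSq_eq_norm_sq, hω]; simp
  ext u v
  simp only [laplacian, incidence, Matrix.mul_apply, Matrix.conjTranspose_apply, Matrix.of_apply]
  rw [Finset.sum_coe_sort H.edges (fun e : V × V =>
    ((if e.1 = (u : V) then (1 : ℂ) else 0) - (if e.2 = (u : V) then starRingEnd ℂ ω else 0)) *
      star ((if e.1 = (v : V) then (1 : ℂ) else 0) -
        (if e.2 = (v : V) then starRingEnd ℂ ω else 0)))]
  by_cases huv : u = v
  · subst huv
    rw [if_pos rfl, degree, Finset.card_filter]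
    push_cast
    refine Finset.sum_congr rfl fun e he => ?_
    have := H.ne_of_mem_edges he
    by_cases h1 : e.1 = u <;> by_cases h2 : e.2 = u
    · exact absurd (h1.trans h2.symm) this
    · simp [h1, h2]
    · simp [h1, h2, hn]
    · simp [h1, h2]
  · have huv' : (u : V) ≠ v := fun h => huv (Subtype.ext h)
    rw [if_neg huv]
    have key : ∀ e ∈ H.edges,
        ((if e.1 = (u : V) then (1 : ℂ) else 0) -
          (if e.2 = (u : V) then starRingEnd ℂ ω else 0)) *
        star ((if e.1 = (v : V) then (1 : ℂ) else 0) -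
          (if e.2 = (v : V) then starRingEnd ℂ ω else 0)) =
        (if e = ((u : V), (v : V)) then -ω else 0) +
          (if e = ((v : V), (u : V)) then -(starRingEnd ℂ ω) else 0) := by
      rintro ⟨a, b⟩ he
      have hab : a ≠ b := H.ne_of_mem_edges he
      by_cases h1 : a = u <;> by_cases h2 : b = u <;> by_cases h3 : a = v <;> by_cases h4 : b = v <;>
        simp_all
    rw [Finset.sum_congr rfl key, Finset.sum_add_distrib, Finset.sum_ite_eq', Finset.sum_ite_eq']
    by_cases h : ((u : V), (v : V)) ∈ H.edges
    · simp [h, H.swap_notMem_edges h]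
    · simp [h]

/-- A property that passes along the edges other than `e₀` holds everywhere or nowhere, if these
edges connect the vertices. -/
lemma forall_of_preconnected_erase {H : G.Substructure} {e₀ : V × V}
    (hT : (H.erase e₀).graph.Preconnected) {P : H.verts → Prop}
    (hP : ∀ u v : H.verts, ((u : V), (v : V)) ∈ H.edges → ((u : V), (v : V)) ≠ e₀ → (P u ↔ P v))
    {r : H.verts} (hr : P r) (v : H.verts) : P v := by
  obtain ⟨w⟩ := hT r v
  induction w with
  | nil => exact hr
  | cons h p ih =>
    refine ih ?_
    rcases h with h | h
    · exact (hP _ _ (Finset.mem_of_mem_erase h) (Finset.ne_of_mem_erase h)).1 hr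
    · exact (hP _ _ (Finset.mem_of_mem_erase h) (Finset.ne_of_mem_erase h)).2 hr

/-! ### Cofactors in the column of one edge -/

section Cramer

variable {R : Type*} [CommRing R]

/-- The incidence matrix made square by a bijection between vertices and edges. -/
def squareIncidence (H : G.Substructure) (σ : H.verts ≃ H.edges) (c : R) :
    Matrix H.verts H.verts R :=
  (H.incidence c).submatrix id σ

lemma squareIncidence_col {H : G.Substructure} {σ : H.verts ≃ H.edges} (c : R) {j u v : H.verts}
    (h : (σ j : V × V) = ((u : V), (v : V))) :
    (fun i => H.squareIncidence σ c i j) = Pi.single u 1 - c • Pi.single v 1 := by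
  ext i
  have hu : (u : V) = i ↔ i = u := by rw [Subtype.ext_iff, eq_comm]
  have hv : (v : V) = i ↔ i = v := by rw [Subtype.ext_iff, eq_comm]
  simp [squareIncidence, incidence, h, Pi.single_apply, hu, hv]

/-- The value at `v` is the cofactor of row `v` in the column `j₀` of the square incidence matrix,
the determinant with the column of the edge `σ j₀` replaced by a basis vector. -/
def cofactor (H : G.Substructure) (σ : H.verts ≃ H.edges) (c : R) (j₀ v : H.verts) : R :=
  ((H.squareIncidence σ c).updateCol j₀ (Pi.single v 1)).det

/-- Replacing the column `j₀` by the column of another edge gives determinant zero. For an edge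
`u → v` this relates the cofactors at `u` and at `v`. -/
lemma cofactor_src {H : G.Substructure} {σ : H.verts ≃ H.edges} (c : R) {j₀ u v : H.verts}
    (h : ((u : V), (v : V)) ∈ H.edges) (hne : ((u : V), (v : V)) ≠ σ j₀) :
    H.cofactor σ c j₀ u = c * H.cofactor σ c j₀ v := by
  obtain ⟨j, hj⟩ := σ.surjective ⟨_, h⟩
  have hj' : (σ j : V × V) = ((u : V), (v : V)) := by rw [hj]
  have hjj : j ≠ j₀ := by rintro rfl; exact hne hj'.symm
  have h0 : Matrix.cramer (H.squareIncidence σ c) (fun i => H.squareIncidence σ c i j) j₀ = 0 := by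
    rw [Matrix.cramer_row_self _ _ j (fun _ => rfl), Pi.single_eq_of_ne hjj.symm]
  rw [squareIncidence_col c hj', map_sub, map_smul] at h0
  exact sub_eq_zero.1 h0

lemma det_squareIncidence {H : G.Substructure} {σ : H.verts ≃ H.edges} (c : R) (j₀ : H.verts) :
    (H.squareIncidence σ c).det =
      Matrix.cramer (H.squareIncidence σ c) (fun i => H.squareIncidence σ c i j₀) j₀ := by
  rw [Matrix.cramer_row_self _ _ j₀ (fun _ => rfl), Pi.single_eq_same]

/-- If the edges other than `σ j₀` connect the vertices, the columns of these edges and one basis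
vector span all the basis vectors, over every ring. -/
lemma isUnit_cofactor {H : G.Substructure} {σ : H.verts ≃ H.edges} {c : R} (hc : IsUnit c)
    {j₀ : H.verts} (hT : (H.erase (σ j₀)).graph.Preconnected) (r : H.verts) :
    IsUnit (H.cofactor σ c j₀ r) := by
  set A := (H.squareIncidence σ c).updateCol j₀ (Pi.single r 1) with hA
  set S := LinearMap.range A.mulVecLin with hS
  have hcol : ∀ j, (fun i => A i j) ∈ S := fun j => ⟨Pi.single j 1, by ext; simp⟩
  have hr : (Pi.single r 1 : H.verts → R) ∈ S := by
    convert! hcol j₀ using 1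
    ext i; simp [hA]
  have hall : ∀ v : H.verts, (Pi.single v 1 : H.verts → R) ∈ S := by
    refine forall_of_preconnected_erase hT (fun u v h hne => ?_) hr
    obtain ⟨j, hj⟩ := σ.surjective ⟨_, h⟩
    have hj' : (σ j : V × V) = ((u : V), (v : V)) := by rw [hj]
    have hjj : j ≠ j₀ := by rintro rfl; exact hne hj'.symm
    have hd : (Pi.single u 1 - c • Pi.single v 1 : H.verts → R) ∈ S := by
      rw [← squareIncidence_col c hj']
      convert! hcol j using 1
      ext i; simp [hA, hjj]
    constructor <;> intro hS'
    · obtain ⟨d, hd'⟩ := hc.exists_left_inv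
      have := S.smul_mem d (S.sub_mem hS' hd)
      rwa [sub_sub_cancel, smul_smul, hd', one_smul] at this
    · simpa using S.add_mem hd (S.smul_mem c hS')
  have hsurj : Function.Surjective A.mulVec := by
    intro y
    have : y ∈ S := by
      rw [← Finset.univ_sum_single y]
      refine S.sum_mem fun v _ => ?_
      simpa [← Pi.single_smul] using S.smul_mem (y v) (hall v)
    exact this
  obtain ⟨B, hB⟩ := Matrix.mulVec_surjective_iff_exists_right_inverse.1 hsurj
  exact Matrix.isUnit_det_of_right_inverse hB

end Cramer

/-- The gauge `v ↦ x v` given by the cofactors themselves turns the matrix of a cofactor into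
the matrix for `c = 1`, which has integer entries and invertible determinant. -/
lemma norm_cofactor {H : G.Substructure} {σ : H.verts ≃ H.edges} {c : ℂ} (hc : ‖c‖ = 1)
    {j₀ : H.verts} (hT : (H.erase (σ j₀)).graph.Preconnected)
    (hin : ∀ e ∈ H.edges, e ≠ σ j₀ → e.1 ∈ H.verts ∧ e.2 ∈ H.verts) (r : H.verts) :
    ‖H.cofactor σ c j₀ r‖ = 1 := by
  have hc0 : IsUnit c := by
    rw [isUnit_iff_ne_zero]; rintro rfl; simp at hc
  set x := H.cofactor σ c j₀ with hx
  have hx0 : ∀ v, x v ≠ 0 := fun v => (isUnit_cofactor hc0 hT v).ne_zero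
  have hnorm : ∀ v, ‖x v‖ = ‖x r‖ := by
    refine forall_of_preconnected_erase hT (fun u v h hne => ?_) rfl
    rw [hx, cofactor_src c h hne, norm_mul, hc, one_mul]
  have hsrc : ∀ j : H.verts, ∃ s : H.verts, j ≠ j₀ → (σ j : V × V).1 = s := fun j => by
    by_cases h : j = j₀
    · exact ⟨r, fun h' => absurd h h'⟩
    · exact ⟨⟨_, (hin _ (σ j).2 (fun h' => h (σ.injective (Subtype.ext h')))).1⟩, fun _ => rfl⟩
  choose s hs using hsrc
  set k : H.verts → ℂ := fun j => if j = j₀ then (x r)⁻¹ else (x (s j))⁻¹ with hk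
  have hknorm : ∀ j, ‖k j‖ = ‖x r‖⁻¹ := fun j => by
    by_cases h : j = j₀
    · simp [hk, h]
    · simp [hk, h, hnorm (s j)]
  have hmat : Matrix.diagonal x *
      ((H.squareIncidence σ c).updateCol j₀ (Pi.single r 1)) * Matrix.diagonal k =
      ((H.squareIncidence σ (1 : ℤ)).updateCol j₀ (Pi.single r 1)).map (Int.castRingHom ℂ) := by
    ext v j
    rw [Matrix.mul_diagonal, Matrix.diagonal_mul]
    by_cases h : j = j₀
    · subst h
      by_cases hv : v = r
      · subst hv; simp [hk, hx0]
      · simp [hv]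
    · have hjne : (σ j : V × V) ≠ σ j₀ := fun h' => h (σ.injective (Subtype.ext h'))
      have ht := (hin _ (σ j).2 hjne).2
      have hrel : x (s j) = c * x ⟨_, ht⟩ := by
        have h1 : (((s j : H.verts) : V), (σ j : V × V).2) = σ j := by rw [← hs j h]
        refine cofactor_src (v := ⟨_, ht⟩) c ?_ ?_
        · rw [h1]; exact (σ j).2
        · rw [h1]; exact hjne
      have hne := H.ne_of_mem_edges (σ j).2
      simp only [Matrix.updateCol_ne h, hk, h, if_false, squareIncidence, incidence,
        Matrix.submatrix_apply, Matrix.map_apply, Matrix.of_apply, id]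
      by_cases h1 : (σ j : V × V).1 = v
      · have h2 : (σ j : V × V).2 ≠ v := fun h2 => hne (h1.trans h2.symm)
        have h3 : s j = v := Subtype.ext ((hs j h).symm.trans h1)
        simp [h1, h2, h3, hx0]
      · by_cases h2 : (σ j : V × V).2 = v
        · have h4 : (⟨_, ht⟩ : H.verts) = v := Subtype.ext h2
          rw [h4] at hrel
          have := hx0 (s j)
          simp only [h1, h2, if_true, if_false]
          rw [hrel] at this ⊢
          simp only [map_sub, map_zero, map_one]
          field_simp [hx0 v, hc0.ne_zero]
          ring
        · simp [h1, h2]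
  have hdet := congrArg (fun M => ‖Matrix.det M‖) hmat
  have hunit : ‖((H.cofactor σ (1 : ℤ) j₀ r : ℤ) : ℂ)‖ = 1 := by
    rcases Int.isUnit_iff.1 (isUnit_cofactor (isUnit_one : IsUnit (1 : ℤ)) hT r) with h | h <;>
      simp [h]
  have hmap : (((H.squareIncidence σ (1 : ℤ)).updateCol j₀ (Pi.single r 1)).map
      (Int.castRingHom ℂ)).det = ((H.cofactor σ (1 : ℤ) j₀ r : ℤ) : ℂ) := by
    rw [cofactor, ← eq_intCast (Int.castRingHom ℂ), RingHom.map_det]; rfl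
  have hr0 : ‖x r‖ ≠ 0 := norm_ne_zero_iff.2 (hx0 r)
  have hp : ‖x r‖ ^ (Fintype.card H.verts) ≠ 0 := pow_ne_zero _ hr0
  simp only [Matrix.det_mul, Matrix.det_diagonal, norm_mul, norm_prod, hnorm, hknorm, hmap,
    hunit, Finset.prod_const, Finset.card_univ, inv_pow] at hdet
  rw [mul_right_comm, mul_inv_cancel₀ hp, one_mul] at hdet
  exact hdet

end OrientedGraph.Substructure

namespace OrientedGraph.Substructure

variable {V : Type*} [DecidableEq V] {G : OrientedGraph V}

/-! ### Trees with a half-open edge -/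

lemma det_laplacian_eq_norm_sq (H : G.Substructure) (σ : H.verts ≃ H.edges) {ω : ℂ}
    (hω : ‖ω‖ = 1) :
    (H.laplacian ω).det =
      ((‖(H.squareIncidence σ (starRingEnd ℂ ω)).det‖ ^ 2 : ℝ) : ℂ) := by
  have h : H.laplacian ω = H.squareIncidence σ (starRingEnd ℂ ω) *
      (H.squareIncidence σ (starRingEnd ℂ ω)).conjTranspose := by
    rw [laplacian_eq_incidence_mul_conjTranspose H hω, squareIncidence,
      Matrix.conjTranspose_submatrix, Matrix.submatrix_mul_equiv, Matrix.submatrix_id_id]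
  rw [h, Matrix.det_mul, Matrix.det_conjTranspose, Complex.star_def, Complex.mul_conj,
    Complex.normSq_eq_norm_sq]

/-- The column of a half-open edge has one nonzero entry, of norm one, so the determinant of the
incidence matrix is a cofactor up to a factor of norm one. -/
lemma det_laplacian_of_half_open {H : G.Substructure} (hreg : H.IsRegular) {e : V × V}
    (he : e ∈ H.edges) (hout : ¬ (e.1 ∈ H.verts ∧ e.2 ∈ H.verts))
    (hinc : e.1 ∈ H.verts ∨ e.2 ∈ H.verts)
    (hin : ∀ e' ∈ H.edges, e' ≠ e → e'.1 ∈ H.verts ∧ e'.2 ∈ H.verts)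
    (hT : (H.erase e).graph.Preconnected) {ω : ℂ} (hω : ‖ω‖ = 1) :
    (H.laplacian ω).det = 1 := by
  set σ := Finset.equivOfCardEq hreg
  set c := starRingEnd ℂ ω
  have hc : ‖c‖ = 1 := by simp [c, hω]
  obtain ⟨j₀, hj₀⟩ := σ.surjective ⟨e, he⟩
  have hj : e = σ j₀ := by rw [hj₀]
  rw [hj] at hT hin
  have hD := fun r => norm_cofactor hc hT hin r
  have hdet : ‖(H.squareIncidence σ c).det‖ = 1 := by
    rw [det_squareIncidence c j₀]
    rcases hinc with h | h
    · have h2 : e.2 ∉ H.verts := fun h2 => hout ⟨h, h2⟩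
      have hcol : (fun i => H.squareIncidence σ c i j₀) = Pi.single ⟨e.1, h⟩ 1 := by
        ext i
        have : e.2 ≠ i := fun h' => h2 (h' ▸ i.2)
        simp [squareIncidence, incidence, hj₀, Pi.single_apply, Subtype.ext_iff, this,
          @eq_comm V e.1 i]
      rw [hcol]
      exact hD _
    · have h1 : e.1 ∉ H.verts := fun h1 => hout ⟨h1, h⟩
      have hcol : (fun i => H.squareIncidence σ c i j₀) = (-c) • Pi.single ⟨e.2, h⟩ 1 := by
        ext i
        have : e.1 ≠ i := fun h' => h1 (h' ▸ i.2)
        simp [squareIncidence, incidence, hj₀, Pi.single_apply, Subtype.ext_iff, this,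
          @eq_comm V e.2 i]
        split_ifs <;> simp
      rw [hcol, map_smul, Pi.smul_apply, norm_smul, norm_neg, hc, one_mul]
      exact hD _
  rw [det_laplacian_eq_norm_sq H σ hω, hdet]
  simp

/-! ### Unicyclic graphs -/

lemma forwardCount_cons (H : G.Substructure) {u v w : H.verts} (h : H.graph.Adj u v)
    (p : H.graph.Walk v w) :
    H.forwardCount (.cons h p) =
      H.forwardCount p + if ((u : V), (v : V)) ∈ H.edges then 1 else 0 := by
  simp [forwardCount, SimpleGraph.Walk.darts_cons, List.countP_cons]

lemma backwardCount_cons (H : G.Substructure) {u v w : H.verts} (h : H.graph.Adj u v)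
    (p : H.graph.Walk v w) :
    H.backwardCount (.cons h p) =
      H.backwardCount p + if ((v : V), (u : V)) ∈ H.edges then 1 else 0 := by
  simp [backwardCount, SimpleGraph.Walk.darts_cons, List.countP_cons]

lemma forwardCount_add_backwardCount (H : G.Substructure) {u v : H.verts}
    (p : H.graph.Walk u v) : H.forwardCount p + H.backwardCount p = p.length := by
  induction p with
  | nil => rfl
  | cons h p ih =>
    rw [forwardCount_cons, backwardCount_cons, SimpleGraph.Walk.length_cons, ← ih]
    rcases h with h | h
    · simp [h, H.swap_notMem_edges h]; ring
    · simp [h, H.swap_notMem_edges h]; ring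

/-- A function multiplied by `ω` along each edge of a walk in the direction of the edge is
multiplied by a power of `ω` along the walk. -/
lemma eq_zpow_mul_of_walk {H : G.Substructure} {ω : ℂ} (hω : ω ≠ 0) {x : H.verts → ℂ}
    {a b : H.verts}
    (hx : ∀ u v : H.verts, ((u : V), (v : V)) ∈ H.edges → s(u, v) ≠ s(a, b) → x v = ω * x u)
    {u v : H.verts} (p : H.graph.Walk u v) (hp : s(a, b) ∉ p.edges) :
    x v = ω ^ ((H.forwardCount p : ℤ) - H.backwardCount p) * x u := by
  induction p with
  | nil => simp [forwardCount, backwardCount]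
  | @cons u v w h p ih =>
    rw [SimpleGraph.Walk.edges_cons, List.mem_cons, not_or] at hp
    rw [ih hp.2, forwardCount_cons, backwardCount_cons]
    rcases h with h | h
    · rw [hx _ _ h (Ne.symm hp.1), if_pos h, if_neg (H.swap_notMem_edges h), ← mul_assoc,
        ← zpow_add_one₀ hω]
      congr 2; push_cast; ring
    · rw [hx _ _ h (by rw [Sym2.eq_swap]; exact Ne.symm hp.1), if_pos h,
        if_neg (H.swap_notMem_edges h), ← mul_assoc, ← zpow_add_one₀ hω]
      congr 2; push_cast; ring

lemma erase_graph (H : G.Substructure) {a b : H.verts} (h : ((a : V), (b : V)) ∈ H.edges) :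
    (H.erase (a, b)).graph = H.graph.deleteEdges {s(a, b)} := by
  refine SimpleGraph.ext (funext₂ fun (u v : H.verts) => propext ?_)
  have hba := H.swap_notMem_edges h
  change (_ ∈ H.edges.erase _ ∨ _ ∈ H.edges.erase _) ↔ _
  simp only [SimpleGraph.deleteEdges_adj, Finset.mem_erase, Set.mem_singleton_iff,
    Sym2.eq_iff, Ne, Prod.mk.injEq, Subtype.ext_iff, graph]
  grind

/-- The cofactors change by powers of `ω` along the cycle, so the column of the remaining edge of
the cycle contributes `1 - ω ^ n` up to a factor of norm one. -/
lemma det_laplacian_of_isCycle {H : G.Substructure} (hreg : H.IsRegular)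
    (hin : ∀ e ∈ H.edges, e.1 ∈ H.verts ∧ e.2 ∈ H.verts) (hconn : H.graph.Connected)
    {u : H.verts} {w : H.graph.Walk u u} (hw : w.IsCycle) {ω : ℂ} (hω : ‖ω‖ = 1) :
    (H.laplacian ω).det =
      ((‖1 - ω ^ ((H.forwardCount w : ℤ) - H.backwardCount w)‖ ^ 2 : ℝ) : ℂ) := by
  have hω0 : ω ≠ 0 := by rintro rfl; simp at hω
  set σ := Finset.equivOfCardEq hreg
  rw [det_laplacian_eq_norm_sq H σ hω]
  congr 2
  set c := starRingEnd ℂ ω with hcdef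
  have hc : ‖c‖ = 1 := by simp [c, hω]
  have hcω : ω * c = 1 := by
    rw [hcdef, Complex.mul_conj, Complex.normSq_eq_norm_sq, hω]; simp
  have hinv : c = ω⁻¹ := eq_inv_of_mul_eq_one_right hcω
  cases w with
  | nil => simp at hw
  | @cons _ v _ h p =>
    have hp : s(u, v) ∉ p.edges := ((SimpleGraph.Walk.cons_isCycle_iff p h).1 hw).2
    have hdel : (H.graph.deleteEdges {s(u, v)}).Connected :=
      hconn.connected_delete_edge_of_not_isBridge fun hb =>
        hb.notMem_edges_of_isCycle hw (by simp)
    -- `a → b` is the edge of the first step of the cycle, which may run along or against it;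
    -- the function `x` consists of the cofactors in the column of this edge
    have main : ∀ a b : H.verts, s(u, v) = s(a, b) → ((a : V), (b : V)) ∈ H.edges →
        ∃ x : H.verts → ℂ, (∀ r, ‖x r‖ = 1) ∧ (H.squareIncidence σ c).det = x a - c * x b ∧
          x u = ω ^ ((H.forwardCount p : ℤ) - H.backwardCount p) * x v := by
      intro a b hab he
      rw [hab] at hp hdel
      rw [← erase_graph H he] at hdel
      obtain ⟨j₀, hj₀⟩ := σ.surjective ⟨_, he⟩
      have hj : ((a : V), (b : V)) = σ j₀ := by rw [hj₀]
      rw [hj] at hdel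
      refine ⟨H.cofactor σ c j₀, norm_cofactor hc hdel.preconnected (fun e he _ => hin e he), ?_, ?_⟩
      · rw [det_squareIncidence c j₀, squareIncidence_col c hj.symm, map_sub, map_smul]
        rfl
      · refine eq_zpow_mul_of_walk hω0 (fun y z hyz hne => ?_) p hp
        rw [cofactor_src c hyz, ← mul_assoc, hcω, one_mul]
        rw [← hj]
        intro h'
        rw [Prod.mk.injEq] at h'
        exact hne (by rw [Subtype.ext h'.1, Subtype.ext h'.2])
    rw [forwardCount_cons, backwardCount_cons]
    rcases h with h | h
    · obtain ⟨x, hx, hdet, hxu⟩ := main u v rfl h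
      rw [hdet, hxu, if_pos h, if_neg (H.swap_notMem_edges h), hinv, ← sub_mul, norm_mul, hx,
        mul_one]
      push_cast
      rw [add_sub_right_comm, add_zero, zpow_add_one₀ hω0, norm_sub_rev]
      have : ∀ y : ℂ, ‖1 - y * ω‖ = ‖ω⁻¹ - y‖ := fun y => by
        rw [← mul_one ‖ω⁻¹ - y‖, ← hω, ← norm_mul, sub_mul, inv_mul_cancel₀ hω0]
      rw [this]
    · obtain ⟨x, hx, hdet, hxu⟩ := main v u Sym2.eq_swap h
      rw [hdet, hxu, if_pos h, if_neg (H.swap_notMem_edges h), hinv, ← mul_assoc,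
        ← one_sub_mul, norm_mul, hx, mul_one]
      push_cast
      rw [add_zero, ← sub_sub, zpow_sub_one₀ hω0, mul_comm]

end OrientedGraph.Substructure

namespace OrientedGraph.Substructure

variable {V : Type*} [DecidableEq V] {G : OrientedGraph V}

/-! ### Structure of connected regular substructures -/

/-- As there are no digons, an undirected edge comes from one directed edge only. -/
lemma card_edgeSet_graph (H : G.Substructure) :
    Nat.card H.graph.edgeSet =
      (H.edges.filter fun e => e.1 ∈ H.verts ∧ e.2 ∈ H.verts).card := by
  set S := H.edges.filter fun e => e.1 ∈ H.verts ∧ e.2 ∈ H.verts with hS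
  have hmem : ∀ e : S, e.1 ∈ H.edges ∧ e.1.1 ∈ H.verts ∧ e.1.2 ∈ H.verts :=
    fun e => Finset.mem_filter.1 e.2
  rw [← Fintype.card_coe, ← Nat.card_eq_fintype_card]
  let f : S → H.graph.edgeSet := fun e =>
    ⟨s(⟨e.1.1, (hmem e).2.1⟩, ⟨e.1.2, (hmem e).2.2⟩), Or.inl (hmem e).1⟩
  refine (Nat.card_eq_of_bijective f ⟨?_, ?_⟩).symm
  · rintro e e' h
    have h1 := congrArg Subtype.val h
    simp only [f, Sym2.eq_iff, Subtype.mk.injEq] at h1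
    rcases h1 with ⟨h1, h2⟩ | ⟨h1, h2⟩
    · exact Subtype.ext (Prod.ext h1 h2)
    · have h3 : ((e.1.1, e.1.2) : V × V) ∈ H.edges := (hmem e).1
      have h4 : ((e'.1.1, e'.1.2) : V × V) ∈ H.edges := (hmem e').1
      rw [← h1, ← h2] at h4
      exact absurd h4 (H.swap_notMem_edges h3)
  · rintro ⟨e, he⟩
    induction e with
    | h u v =>
      rcases he with he | he
      · exact ⟨⟨(u, v), by simp [hS, he]⟩, rfl⟩
      · exact ⟨⟨(v, u), by simp [hS, he]⟩, Subtype.ext Sym2.eq_swap⟩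

lemma card_edgeSet_graph_of_forall_mem {H : G.Substructure}
    (hin : ∀ e ∈ H.edges, e.1 ∈ H.verts ∧ e.2 ∈ H.verts) :
    Nat.card H.graph.edgeSet = H.edges.card := by
  rw [card_edgeSet_graph, Finset.filter_true_of_mem hin]

/-- A connected graph with as many edges as vertices contains a cycle. Without an edge of this
cycle it is a tree, so that each edge of one cycle lies on every other. -/
lemma exists_isUnicyclic {H : G.Substructure} (hreg : H.IsRegular) (hconn : H.graph.Connected)
    (hin : ∀ e ∈ H.edges, e.1 ∈ H.verts ∧ e.2 ∈ H.verts) : ∃ k g, H.IsUnicyclic k g := by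
  have hcard : Nat.card H.graph.edgeSet = Nat.card H.verts := by
    rw [card_edgeSet_graph_of_forall_mem hin, ← hreg, Nat.card_eq_fintype_card, Fintype.card_coe]
  have hcyc : ¬ H.graph.IsAcyclic := fun h => by
    have := (SimpleGraph.isTree_iff_connected_and_card.1 ⟨hconn, h⟩).2
    omega
  simp only [SimpleGraph.IsAcyclic, not_forall, not_not] at hcyc
  obtain ⟨u, w, hw⟩ := hcyc
  have hsub : ∀ {u₁ u₂ : H.verts} (w₁ : H.graph.Walk u₁ u₁) (w₂ : H.graph.Walk u₂ u₂),
      w₁.IsCycle → w₂.IsCycle → ∀ e ∈ w₁.edges, e ∈ w₂.edges := by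
    intro u₁ u₂ w₁ w₂ h₁ h₂ e he
    by_contra hne
    have hdel : (H.graph.deleteEdges {e}).Connected := by
      induction e with
      | h a b =>
        exact hconn.connected_delete_edge_of_not_isBridge fun hb =>
          hb.notMem_edges_of_isCycle h₁ he
    have htree : (H.graph.deleteEdges {e}).IsTree := by
      refine SimpleGraph.isTree_iff_connected_and_card.2 ⟨hdel, ?_⟩
      rw [SimpleGraph.edgeSet_deleteEdges, ← hcard, Nat.card_coe_set_eq, Nat.card_coe_set_eq]
      exact Set.ncard_sdiff_singleton_add_one (w₁.edges_subset_edgeSet he) (Set.toFinite _)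
    exact htree.isAcyclic _ (SimpleGraph.Walk.IsCycle.toDeleteEdges _ {e} h₂ (by rintro _ h rfl; exact hne h))
  exact ⟨_, _, hin, hconn, u, w, hw, rfl, rfl, fun u' w' hw' e =>
    ⟨hsub w' w hw' hw e, hsub w w' hw hw' e⟩⟩

/-- A connected regular substructure with a half-open edge is a tree and that one edge. -/
lemma det_laplacian_eq_one {H : G.Substructure} (hreg : H.IsRegular) (hconn : H.graph.Connected)
    (hinc : ∀ e ∈ H.edges, e.1 ∈ H.verts ∨ e.2 ∈ H.verts)
    (hout : ¬ ∀ e ∈ H.edges, e.1 ∈ H.verts ∧ e.2 ∈ H.verts) {ω : ℂ} (hω : ‖ω‖ = 1) :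
    (H.laplacian ω).det = 1 := by
  push Not at hout
  obtain ⟨e, he, heout⟩ := hout
  have hle := hconn.card_vert_le_card_edgeSet_add_one
  rw [card_edgeSet_graph, Nat.card_eq_fintype_card, Fintype.card_coe,
    show H.verts.card = H.edges.card from hreg,
    ← Finset.card_filter_add_card_filter_not (s := H.edges)
      (fun e => e.1 ∈ H.verts ∧ e.2 ∈ H.verts)] at hle
  have hone := Finset.card_le_one.1 (Nat.le_of_add_le_add_left hle)
  have hin : ∀ e' ∈ H.edges, e' ≠ e → e'.1 ∈ H.verts ∧ e'.2 ∈ H.verts := by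
    intro e' he' hne
    by_contra hc
    exact hne (hone e' (Finset.mem_filter.2 ⟨he', hc⟩) e
      (Finset.mem_filter.2 ⟨he, fun h => heout h.1 h.2⟩))
  refine det_laplacian_of_half_open hreg he (fun h => heout h.1 h.2) (hinc e he) hin ?_ hω
  have hgr : (H.erase e).graph = H.graph := by
    refine SimpleGraph.ext (funext₂ fun (u v : H.verts) => propext ?_)
    have h : ∀ u v : H.verts, ((u : V), (v : V)) ≠ e := by
      rintro u v rfl
      exact heout u.2 v.2
    change (_ ∈ H.edges.erase _ ∨ _ ∈ H.edges.erase _) ↔ _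
    simp [Finset.mem_erase, h, graph]
  rw [hgr]
  exact hconn.preconnected

/-- Up to its sign, `k - 2g` is the difference of the two counts, and the sign does not matter
because `1 - ω ^ n` and `1 - ω ^ (-n)` have the same norm. -/
lemma IsUnicyclic.det_laplacian {H : G.Substructure} (hreg : H.IsRegular) {k g : ℕ}
    (h : H.IsUnicyclic k g) {ω : ℂ} (hω : ‖ω‖ = 1) :
    (H.laplacian ω).det = ((‖1 - ω ^ ((k : ℤ) - 2 * g)‖ ^ 2 : ℝ) : ℂ) := by
  obtain ⟨hin, hconn, u, w, hw, rfl, rfl, -⟩ := h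
  rw [det_laplacian_of_isCycle hreg hin hconn hw hω]
  have hsum := H.forwardCount_add_backwardCount w
  have hω0 : ω ≠ 0 := by rintro rfl; simp at hω
  have hneg : ∀ n : ℤ, ‖1 - ω ^ (-n)‖ = ‖1 - ω ^ n‖ := fun n => by
    have h1 : 1 - ω ^ n = -(ω ^ n * (1 - ω ^ (-n))) := by
      rw [mul_sub, ← zpow_add₀ hω0]; simp
    rw [h1, norm_neg, norm_mul, norm_zpow, hω, one_zpow, one_mul]
  congr 2
  rw [negativeCount]
  rcases le_total (H.forwardCount w) (H.backwardCount w) with hle | hle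
  · rw [min_eq_left hle, ← hneg]
    congr 3; omega
  · rw [min_eq_right hle]
    congr 3; omega

end OrientedGraph.Substructure

namespace OrientedGraph.Substructure

variable {V : Type*} {G : OrientedGraph V}

/-! ### Decomposition into connected components -/

lemma mem_component_verts {H : G.Substructure} {c : H.graph.ConnectedComponent} {v : V} :
    v ∈ (H.component c).verts ↔ H.InComponent c v := by
  simp only [component, Finset.mem_filter, and_iff_right_iff_imp]
  exact fun h => h.1

lemma mem_component_edges {H : G.Substructure} {c : H.graph.ConnectedComponent} {e : V × V} :
    e ∈ (H.component c).edges ↔ e ∈ H.edges ∧ (H.InComponent c e.1 ∨ H.InComponent c e.2) := by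
  simp only [component, Finset.mem_filter]

lemma mem_verts_of_mem_component_edges {H : G.Substructure} {c : H.graph.ConnectedComponent}
    {e : V × V} (he : e ∈ (H.component c).edges) :
    e.1 ∈ (H.component c).verts ∨ e.2 ∈ (H.component c).verts := by
  simpa only [mem_component_verts] using (mem_component_edges.1 he).2

lemma component_graph_connected (H : G.Substructure) (c : H.graph.ConnectedComponent) :
    (H.component c).graph.Connected := by
  have key : ∀ (u v : H.verts) (_ : H.graph.Walk u v) (hu : H.InComponent c u)
      (hv : H.InComponent c v), (H.component c).graph.Reachable
        ⟨u, mem_component_verts.2 hu⟩ ⟨v, mem_component_verts.2 hv⟩ := by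
    intro u v p
    induction p with
    | nil => intro hu hv; rfl
    | @cons a b d h p ih =>
      intro hu hv
      obtain ⟨h', ha⟩ := hu
      have hb : H.InComponent c b :=
        ⟨b.2, (SimpleGraph.ConnectedComponent.connectedComponentMk_eq_of_adj h).symm.trans ha⟩
      refine SimpleGraph.Reachable.trans (SimpleGraph.Adj.reachable ?_) (ih hb hv)
      rcases h with h | h
      · exact Or.inl (mem_component_edges.2 ⟨h, Or.inr hb⟩)
      · exact Or.inr (mem_component_edges.2 ⟨h, Or.inl hb⟩)
  have hne : ∃ v : H.verts, H.graph.connectedComponentMk v = c := c.exists_rep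
  obtain ⟨v, hv⟩ := hne
  have : Nonempty (H.component c).verts := ⟨⟨v, mem_component_verts.2 ⟨v.2, hv⟩⟩⟩
  refine SimpleGraph.Connected.mk fun a b => ?_
  obtain ⟨ha, ha'⟩ := mem_component_verts.1 a.2
  obtain ⟨hb, hb'⟩ := mem_component_verts.1 b.2
  obtain ⟨p⟩ := SimpleGraph.ConnectedComponent.exact (ha'.trans hb'.symm)
  exact key _ _ p ⟨ha, ha'⟩ ⟨hb, hb'⟩

variable [DecidableEq V]

lemma degree_component {H : G.Substructure} {c : H.graph.ConnectedComponent} {u : V}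
    (hu : H.InComponent c u) : (H.component c).degree u = H.degree u := by
  unfold degree
  congr 1
  ext e
  simp only [Finset.mem_filter, mem_component_edges]
  constructor
  · exact fun h => ⟨h.1.1, h.2⟩
  · rintro ⟨he, rfl | rfl⟩
    · exact ⟨⟨he, Or.inl hu⟩, Or.inl rfl⟩
    · exact ⟨⟨he, Or.inr hu⟩, Or.inr rfl⟩

open Classical in
/-- The Laplacian matrix is block diagonal, with one block for each connected component. -/
lemma det_laplacian_eq_prod_component (H : G.Substructure) (ω : ℂ) :
    (H.laplacian ω).det = ∏ c, ((H.component c).laplacian ω).det := by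
  -- an arbitrary linear order on the set of components, used to arrange the blocks
  let _ : LinearOrder H.graph.ConnectedComponent :=
    LinearOrder.lift' (Fintype.equivFin _) (Fintype.equivFin _).injective
  have hblock : (H.laplacian ω).BlockTriangular H.graph.connectedComponentMk := by
    intro u v huv
    have hadj : ¬ H.graph.Adj u v := fun h =>
      huv.ne' (SimpleGraph.ConnectedComponent.connectedComponentMk_eq_of_adj h)
    have hne : u ≠ v := by rintro rfl; exact lt_irrefl _ huv
    simp only [graph, not_or] at hadj
    simp [laplacian, hne, hadj.1, hadj.2]
  rw [hblock.det_fintype]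
  refine Finset.prod_congr rfl fun c _ => ?_
  let e : {v : H.verts // H.graph.connectedComponentMk v = c} ≃ (H.component c).verts :=
    { toFun := fun v => ⟨v.1, mem_component_verts.2 ⟨v.1.2, v.2⟩⟩
      invFun := fun v => ⟨⟨v, (mem_component_verts.1 v.2).1⟩, (mem_component_verts.1 v.2).2⟩
      left_inv := fun v => rfl
      right_inv := fun v => rfl }
  have he : (H.laplacian ω).toSquareBlock H.graph.connectedComponentMk c =
      ((H.component c).laplacian ω).submatrix e e := by
    ext ⟨u, hu⟩ ⟨v, hv⟩
    have hu' : H.InComponent c u := ⟨u.2, hu⟩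
    have hv' : H.InComponent c v := ⟨v.2, hv⟩
    have hiff : e ⟨u, hu⟩ = e ⟨v, hv⟩ ↔ u = v := by rw [e.apply_eq_iff_eq, Subtype.mk.injEq]
    have huv : ((u : V), (v : V)) ∈ (H.component c).edges ↔ ((u : V), (v : V)) ∈ H.edges := by
      rw [mem_component_edges]; exact and_iff_left (Or.inl hu')
    have hvu : ((v : V), (u : V)) ∈ (H.component c).edges ↔ ((v : V), (u : V)) ∈ H.edges := by
      rw [mem_component_edges]; exact and_iff_left (Or.inl hv')
    change _ = if e ⟨u, hu⟩ = e ⟨v, hv⟩ then ((H.component c).degree u : ℂ) else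
      if ((u : V), (v : V)) ∈ (H.component c).edges then -ω else
      if ((v : V), (u : V)) ∈ (H.component c).edges then -(starRingEnd ℂ) ω else 0
    simp only [hiff, huv, hvu, degree_component hu']
    rfl
  rw [he]
  convert! Matrix.det_submatrix_equiv_self e _

end OrientedGraph.Substructure

/-! ### The values of `‖1 - ω ^ n‖ ^ 2` at fifth roots of unity -/

lemma norm_omegaFive : ‖omegaFive‖ = 1 := by
  have h : omegaFive = Complex.exp ((2 * Real.pi / 5 : ℝ) * Complex.I) := by
    rw [omegaFive]; push_cast; ring_nf
  rw [h, Complex.norm_exp_ofReal_mul_I]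

lemma norm_one_sub_omegaFive_zpow_sq (n : ℤ) :
    ‖1 - omegaFive ^ n‖ ^ 2 = 2 - 2 * Real.cos (n * (2 * Real.pi / 5)) := by
  have h : omegaFive ^ n = Complex.exp ((n * (2 * Real.pi / 5) : ℝ) * Complex.I) := by
    rw [omegaFive, ← Complex.exp_int_mul]; push_cast; ring_nf
  rw [h, ← Complex.normSq_eq_norm_sq, Complex.normSq_apply, Complex.sub_re, Complex.sub_im,
    Complex.exp_ofReal_mul_I_re, Complex.exp_ofReal_mul_I_im, Complex.one_re, Complex.one_im]
  linear_combination Real.sin_sq_add_cos_sq (n * (2 * Real.pi / 5))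

lemma omegaFive_sq_zpow (n : ℤ) : (omegaFive ^ 2) ^ n = omegaFive ^ (2 * n) :=
  (zpow_mul omegaFive 2 n).symm

lemma sqrt_five_mul_goldenRatio : √5 * Real.goldenRatio = (5 + √5) / 2 := by
  have h : √5 * √5 = (5 : ℝ) := Real.mul_self_sqrt (by norm_num)
  rw [Real.goldenRatio]; linear_combination h / 2

lemma sqrt_five_div_goldenRatio : √5 / Real.goldenRatio = (5 - √5) / 2 := by
  have h : √5 * √5 = (5 : ℝ) := Real.mul_self_sqrt (by norm_num)
  rw [div_eq_iff Real.goldenRatio_ne_zero, Real.goldenRatio]; linear_combination h / 4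

lemma cos_int_mul_two_pi_div_five (n q r : ℤ) (h : n = r + q * 5) :
    Real.cos (n * (2 * Real.pi / 5)) = Real.cos (r * (2 * Real.pi / 5)) := by
  rw [h, ← Real.cos_add_int_mul_two_pi (r * (2 * Real.pi / 5)) q]
  push_cast; ring_nf

lemma cos_two_pi_div_five : Real.cos (2 * Real.pi / 5) = (√5 - 1) / 4 := by
  have h : √5 * √5 = (5 : ℝ) := Real.mul_self_sqrt (by norm_num)
  rw [mul_div_assoc, Real.cos_two_mul, Real.cos_pi_div_five]
  linear_combination h / 8

lemma norm_one_sub_omegaFive_zpow_sq_of_modEq_two {n : ℤ}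
    (h : n ≡ 2 [ZMOD 5] ∨ n ≡ 3 [ZMOD 5]) :
    ‖1 - omegaFive ^ n‖ ^ 2 = √5 * Real.goldenRatio := by
  have h5 : √5 * √5 = (5 : ℝ) := Real.mul_self_sqrt (by norm_num)
  have hcos : Real.cos (n * (2 * Real.pi / 5)) = Real.cos (2 * (2 * Real.pi / 5)) := by
    rcases h with h | h
    · obtain ⟨q, hq⟩ := h.symm.dvd
      rw [cos_int_mul_two_pi_div_five n q 2 (by linarith)]; norm_num
    · obtain ⟨q, hq⟩ := h.symm.dvd
      rw [cos_int_mul_two_pi_div_five n (q + 1) (-2) (by linarith), ← Real.cos_neg]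
      congr 1; push_cast; ring
  rw [norm_one_sub_omegaFive_zpow_sq, hcos, Real.cos_two_mul, cos_two_pi_div_five,
    sqrt_five_mul_goldenRatio]
  linear_combination -h5 / 4

lemma norm_one_sub_omegaFive_zpow_sq_of_modEq_one {n : ℤ}
    (h : n ≡ 1 [ZMOD 5] ∨ n ≡ 4 [ZMOD 5]) :
    ‖1 - omegaFive ^ n‖ ^ 2 = √5 / Real.goldenRatio := by
  have hcos : Real.cos (n * (2 * Real.pi / 5)) = Real.cos (2 * Real.pi / 5) := by
    rcases h with h | h
    · obtain ⟨q, hq⟩ := h.symm.dvd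
      rw [cos_int_mul_two_pi_div_five n q 1 (by linarith)]; norm_num
    · obtain ⟨q, hq⟩ := h.symm.dvd
      rw [cos_int_mul_two_pi_div_five n (q + 1) (-1) (by linarith), ← Real.cos_neg]
      congr 1; push_cast; ring
  rw [norm_one_sub_omegaFive_zpow_sq, hcos, cos_two_pi_div_five, sqrt_five_div_goldenRatio]
  ring

lemma sqrt_five_div_lt_sqrt_five_mul_goldenRatio :
    √5 / Real.goldenRatio < √5 * Real.goldenRatio := by
  rw [sqrt_five_div_goldenRatio, sqrt_five_mul_goldenRatio]
  have : 0 < √(5 : ℝ) := by positivity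
  linarith

/-! ### Determinants of alpha and beta components -/

namespace OrientedGraph.Substructure

variable {V : Type*} [DecidableEq V] {G : OrientedGraph V}

lemma IsAlpha.det_laplacian {H : G.Substructure} (hreg : H.IsRegular) (h : H.IsAlpha) :
    (H.laplacian omegaFive).det = ((√5 * Real.goldenRatio : ℝ) : ℂ) ∧
      (H.laplacian (omegaFive ^ 2)).det = ((√5 / Real.goldenRatio : ℝ) : ℂ) := by
  obtain ⟨k, g, hu, hmod⟩ := h
  constructor
  · rw [hu.det_laplacian hreg norm_omegaFive, norm_one_sub_omegaFive_zpow_sq_of_modEq_two hmod]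
  · rw [hu.det_laplacian hreg (by rw [norm_pow, norm_omegaFive, one_pow]),
      omegaFive_sq_zpow, norm_one_sub_omegaFive_zpow_sq_of_modEq_one]
    simp only [Int.ModEq] at hmod ⊢
    omega

lemma IsBeta.det_laplacian {H : G.Substructure} (hreg : H.IsRegular) (h : H.IsBeta) :
    (H.laplacian omegaFive).det = ((√5 / Real.goldenRatio : ℝ) : ℂ) ∧
      (H.laplacian (omegaFive ^ 2)).det = ((√5 * Real.goldenRatio : ℝ) : ℂ) := by
  obtain ⟨k, g, hu, hmod⟩ := h
  constructor
  · rw [hu.det_laplacian hreg norm_omegaFive, norm_one_sub_omegaFive_zpow_sq_of_modEq_one hmod]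
  · rw [hu.det_laplacian hreg (by rw [norm_pow, norm_omegaFive, one_pow]),
      omegaFive_sq_zpow, norm_one_sub_omegaFive_zpow_sq_of_modEq_two]
    simp only [Int.ModEq] at hmod ⊢
    omega

/-- No uniqueness of `k` and `g` is needed here: the determinant at `ω₅` tells the classes
apart. -/
lemma IsAlpha.not_isBeta {H : G.Substructure} (hreg : H.IsRegular) (h : H.IsAlpha) :
    ¬ H.IsBeta := fun h' => by
  have h1 := (h.det_laplacian hreg).1.symm.trans (h'.det_laplacian hreg).1
  exact sqrt_five_div_lt_sqrt_five_mul_goldenRatio.ne' (Complex.ofReal_injective h1)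

lemma IsUnicyclic.isAlpha_or_isBeta_or_isVanishing {H : G.Substructure} {k g : ℕ}
    (h : H.IsUnicyclic k g) : H.IsAlpha ∨ H.IsBeta ∨ H.IsVanishing := by
  have : (k : ℤ) - 2 * g ≡ 2 [ZMOD 5] ∨ (k : ℤ) - 2 * g ≡ 3 [ZMOD 5] ∨
      (k : ℤ) - 2 * g ≡ 1 [ZMOD 5] ∨ (k : ℤ) - 2 * g ≡ 4 [ZMOD 5] ∨
      (5 : ℤ) ∣ (k : ℤ) - 2 * g := by
    simp only [Int.ModEq]; omega
  rcases this with h1 | h1 | h1 | h1 | h1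
  · exact Or.inl ⟨k, g, h, Or.inl h1⟩
  · exact Or.inl ⟨k, g, h, Or.inr h1⟩
  · exact Or.inr (Or.inl ⟨k, g, h, Or.inl h1⟩)
  · exact Or.inr (Or.inl ⟨k, g, h, Or.inr h1⟩)
  · exact Or.inr (Or.inr ⟨k, g, h, h1⟩)

open Classical in
/-- The factor of one component. In an all-regular substructure, a component that is neither alpha
nor beta nor vanishing has a half-open edge and contributes `1`. -/
lemma det_laplacian_component {H : G.Substructure} (hreg : H.IsAllRegular)
    (h0 : H.numVanishing = 0) (c : H.graph.ConnectedComponent) :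
    ((H.component c).laplacian omegaFive).det =
        (((if (H.component c).IsAlpha then √5 * Real.goldenRatio else 1) *
          (if (H.component c).IsBeta then √5 / Real.goldenRatio else 1) : ℝ) : ℂ) ∧
      ((H.component c).laplacian (omegaFive ^ 2)).det =
        (((if (H.component c).IsAlpha then √5 / Real.goldenRatio else 1) *
          (if (H.component c).IsBeta then √5 * Real.goldenRatio else 1) : ℝ) : ℂ) := by
  have hr := hreg c
  by_cases hα : (H.component c).IsAlpha
  · simpa only [hα, hα.not_isBeta hr, if_true, if_false, mul_one] using hα.det_laplacian hr
  by_cases hβ : (H.component c).IsBeta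
  · simpa only [hα, hβ, if_true, if_false, one_mul] using hβ.det_laplacian hr
  have hv : ¬ (H.component c).IsVanishing := fun h => by
    rw [numVanishing, Set.ncard_eq_zero (Set.toFinite _)] at h0
    exact Set.notMem_empty c (h0 ▸ h : c ∈ (∅ : Set H.graph.ConnectedComponent))
  have hout : ¬ ∀ e ∈ (H.component c).edges,
      e.1 ∈ (H.component c).verts ∧ e.2 ∈ (H.component c).verts := fun hin => by
    obtain ⟨k, g, hu⟩ := exists_isUnicyclic hr (H.component_graph_connected c) hin
    rcases hu.isAlpha_or_isBeta_or_isVanishing with h | h | h <;> contradiction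
  have hone := fun {ω : ℂ} (hω : ‖ω‖ = 1) => det_laplacian_eq_one hr
    (H.component_graph_connected c) (fun e he => mem_verts_of_mem_component_edges he) hout hω
  rw [hone norm_omegaFive, hone (by rw [norm_pow, norm_omegaFive, one_pow])]
  simp [hα, hβ]

end OrientedGraph.Substructure

/-! ### The numbers of alpha and beta components -/

theorem mainTheorem3 {V : Type*} [Fintype V] [DecidableEq V] (G : OrientedGraph V)
    (G' : G.Substructure) (hG' : G'.IsAllRegular) (nα nβ : ℕ)
    (hα : G'.numAlpha = nα) (hβ : G'.numBeta = nβ) (h0 : G'.numVanishing = 0) :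
    ∃ d₁ d₂ : ℝ, 0 < d₁ ∧ 0 < d₂ ∧
      (G'.laplacian omegaFive).det = (d₁ : ℂ) ∧
      (G'.laplacian (omegaFive ^ 2)).det = (d₂ : ℂ) ∧
      (nα : ℝ) + (nβ : ℝ) = Real.logb 5 (d₁ * d₂) ∧
      (nα : ℝ) - (nβ : ℝ) = Real.logb (Real.goldenRatio ^ 2) (d₁ / d₂) := by
  classical
  have hprod : ∀ a b : ℝ, ∏ c : G'.graph.ConnectedComponent,
      ((if (G'.component c).IsAlpha then a else 1) *
        (if (G'.component c).IsBeta then b else 1)) = a ^ nα * b ^ nβ := by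
    intro a b
    rw [Finset.prod_mul_distrib, ← Finset.prod_filter, ← Finset.prod_filter, Finset.prod_const,
      Finset.prod_const, ← hα, ← hβ, OrientedGraph.Substructure.numAlpha,
      OrientedGraph.Substructure.numBeta]
    simp only [← Set.ncard_coe_finset, Finset.coe_filter, Finset.mem_univ, true_and]
  have hφ := Real.goldenRatio_pos
  have hφ0 := hφ.ne'
  have hφ1 := Real.one_lt_goldenRatio
  have h5 : √5 * √5 = (5 : ℝ) := Real.mul_self_sqrt (by norm_num)
  have h50 : √(5 : ℝ) ≠ 0 := by positivity
  refine ⟨(√5 * Real.goldenRatio) ^ nα * (√5 / Real.goldenRatio) ^ nβ,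
    (√5 / Real.goldenRatio) ^ nα * (√5 * Real.goldenRatio) ^ nβ, by positivity, by positivity,
    ?_, ?_, ?_, ?_⟩
  · rw [OrientedGraph.Substructure.det_laplacian_eq_prod_component, ← hprod, Complex.ofReal_prod]
    exact Finset.prod_congr rfl fun c _ =>
      (OrientedGraph.Substructure.det_laplacian_component hG' h0 c).1
  · rw [OrientedGraph.Substructure.det_laplacian_eq_prod_component, ← hprod, Complex.ofReal_prod]
    exact Finset.prod_congr rfl fun c _ =>
      (OrientedGraph.Substructure.det_laplacian_component hG' h0 c).2
  · have h : (√5 * Real.goldenRatio) ^ nα * (√5 / Real.goldenRatio) ^ nβ *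
        ((√5 / Real.goldenRatio) ^ nα * (√5 * Real.goldenRatio) ^ nβ) = (5 : ℝ) ^ (nα + nβ) := by
      rw [mul_mul_mul_comm, ← mul_pow, ← mul_pow, pow_add]
      congr 2 <;> field_simp <;> nlinarith
    rw [h, Real.logb_pow, Real.logb_self_eq_one (by norm_num)]
    push_cast; ring
  · have h : (√5 * Real.goldenRatio) ^ nα * (√5 / Real.goldenRatio) ^ nβ /
        ((√5 / Real.goldenRatio) ^ nα * (√5 * Real.goldenRatio) ^ nβ) =
        (Real.goldenRatio ^ 2) ^ nα / (Real.goldenRatio ^ 2) ^ nβ := by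
      rw [mul_div_mul_comm, ← div_pow, ← div_pow, div_eq_mul_inv (_ ^ nα), ← inv_pow]
      congr 2 <;> field_simp
    have hb : Real.logb (Real.goldenRatio ^ 2) (Real.goldenRatio ^ 2) = 1 :=
      Real.logb_self_eq_one (one_lt_pow₀ hφ1 two_ne_zero)
    rw [h, Real.logb_div (by positivity) (by positivity), Real.logb_pow _ _ nα,
      Real.logb_pow _ _ nβ, hb, mul_one, mul_one]
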